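/- Let $(X_t)_{t\ge 0}$ be an irreducible continuous-time Markov chain on a finite set $E$ with jump rates $w_{xy}\ge 0$ from $x$ to $y$ ($x\ne y$), with right-continuous paths with left limits (almost surely), and with generator $\mathbb W=\sum_{x\neq y}w_{xy}|x\rangle\langle y|-\sum_x\big(\sum_{z\ne x}w_{xz}\big)|x\rangle\langle x|$. Let $\pi$ be its stationary distribution, $\langle\pi|\mathbb W=0$, and let $X_0$ have law $\pi$. Write $|-\rangle$ for the constant function $1$ on $E$. For real coefficients $a_{xy}$ ($x\neq y$) let $A(t)=\sum_{x\neq y}a_{xy}N_{xy}(t)$, where $N_{xy}(t)$ is the number of jumps of $X$ from $x$ to $y$ during $(0,t]$. Let $\mathbb W_u=\mathbb W+\sum_{x\ne y}(e^{ua_{xy}}-1)w_{xy}|x\rangle\langle y|$ for $u\in\mathbb R$, let $\mathbb W'_0$ be its derivative with respect to $u$ at $u=0$, and let $\langle a^2\rangle_\pi=\sum_{x\ne y}\pi_xw_{xy}a_{xy}^2$. Then $\mathbb W+|-\rangle\langle\pi|$ is invertible. Let $\mathbb W^{-1}:=(\mathbb W+|-\rangle\langle\pi|)^{-1}-|-\rangle\langle\pi|$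 denote the pseudoinverse of $\mathbb W$. For every $t\ge 0$ the random variable $A(t)$ is square integrable, and its variance is $$\sigma^2_\pi(t)=t\langle a^2\rangle_\pi+2\,\langle\pi|\,\mathbb W'_0\big((e^{t\mathbb W}-\mathbb I)(\mathbb W^{-1})^2-t\,\mathbb W^{-1}\big)\mathbb W'_0\,|-\rangle .$$ Moreover $$\lim_{t\to\infty}\frac{\sigma^2_\pi(t)}{t}=\langle a^2\rangle_\pi-2\langle\pi|\mathbb W'_0\,\mathbb W^{-1}\,\mathbb W'_0|-\rangle,\qquad \lim_{t\downarrow 0}\frac{\sigma^2_\pi(t)}{t}=\langle a^2\rangle_\pi .$$ -/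

import Mathlib

open MeasureTheory ProbabilityTheory Filter Topology
open scoped NNReal Matrix

noncomputable section

namespace JumpChain

variable {E : Type*} [Fintype E] [DecidableEq E]

/-- The generator of the chain with jump rates `w x y` from `x` to `y` (`x ≠ y`): the diagonal
entry at `x` is minus the escape rate `∑ z ≠ x, w x z`. The values `w x x` are never used. -/
def generator (w : E → E → ℝ) : Matrix E E ℝ :=
  Matrix.of fun x y => if x = y then -∑ z with z ≠ x, w x z else w x y

/-- Every state can be reached from every other one through jumps of positive rate. -/
def IsIrreducible (w : E → E → ℝ) : Prop :=
  ∀ x y, Relation.ReflTransGen (fun x' y' => x' ≠ y' ∧ 0 < w x' y') x y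

/-- `p` is a stationary probability vector of the chain: `⟨p| W = 0`. -/
structure IsStationary (w : E → E → ℝ) (p : E → ℝ) : Prop where
  nonneg : ∀ x, 0 ≤ p x
  sum_eq_one : ∑ x, p x = 1
  vecMul_generator : p ᵥ* generator w = 0

/-- The tilted generator `W_u = ∑_{x ≠ y} (e^{u a_{xy}} - 1) w_{xy} |x⟩⟨y| + W`. -/
def tiltedGenerator (w a : E → E → ℝ) (u : ℝ) : Matrix E E ℝ :=
  (Matrix.of fun x y => if x = y then 0 else (Real.exp (u * a x y) - 1) * w x y) + generator w

/-- The (entrywise) derivative `W'_0` of `u ↦ W_u` at `u = 0`. -/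
def tiltedGeneratorDeriv (w a : E → E → ℝ) : Matrix E E ℝ :=
  Matrix.of fun x y => deriv (fun u => tiltedGenerator w a u x y) 0

/-- The matrix `|-⟩⟨p|`, where `|-⟩` is the constant function one. -/
def oneProj (p : E → ℝ) : Matrix E E ℝ :=
  Matrix.vecMulVec 1 p

/-- The pseudoinverse `W^{-1} = (W + |-⟩⟨p|)^{-1} - |-⟩⟨p|` of the generator. -/
def pseudoinverse (w : E → E → ℝ) (p : E → ℝ) : Matrix E E ℝ :=
  (generator w + oneProj p)⁻¹ - oneProj p

/-- `⟨a²⟩_p = ∑_{x ≠ y} p_x w_{xy} a_{xy}²`. -/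
def meanSq (w a : E → E → ℝ) (p : E → ℝ) : ℝ :=
  ∑ x, ∑ y with y ≠ x, p x * w x y * a x y ^ 2

/-- `X` is a continuous-time Markov chain with jump rates `w` and initial law `p`, on the
probability space `(Ω, μ)`: its finite-dimensional distributions are those given by `p` and the
semigroup `e^{tW}`, and almost surely its paths are right-continuous with left limits
(for the discrete topology of the state space). -/
structure IsMarkovChain {Ω : Type*} [MeasurableSpace Ω] (w : E → E → ℝ) (p : E → ℝ)
    (μ : Measure Ω) (X : ℝ≥0 → Ω → E) : Prop where
  measurableSet_eq : ∀ t x, MeasurableSet {ω | X t ω = x}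
  finDimDistrib : ∀ (n : ℕ) (t : Fin (n + 1) → ℝ≥0) (x : Fin (n + 1) → E), Monotone t →
    μ.real {ω | ∀ i, X (t i) ω = x i} =
      (p ᵥ* NormedSpace.exp ((t 0 : ℝ) • generator w)) (x 0) *
        ∏ i : Fin n, NormedSpace.exp
          (((t i.succ : ℝ) - (t i.castSucc : ℝ)) • generator w) (x i.castSucc) (x i.succ)
  rightCont : ∀ᵐ ω ∂μ, ∀ t : ℝ≥0, ∀ᶠ s in 𝓝[>] t, X s ω = X t ω
  leftLim : ∀ᵐ ω ∂μ, ∀ t : ℝ≥0, 0 < t → ∃ x, ∀ᶠ s in 𝓝[<] t, X s ω = x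

/-- `N_{xy}(t)` along a path: the number of times `s ∈ (0, t]` at which the path jumps from `x`
(its left limit at `s`) to `y` (its value at `s`). -/
def jumpCount {E : Type*} (path : ℝ≥0 → E) (x y : E) (t : ℝ≥0) : ℕ :=
  Set.ncard {s : ℝ≥0 | 0 < s ∧ s ≤ t ∧ (∀ᶠ r in 𝓝[<] s, path r = x) ∧ path s = y}

/-- The trajectory observable `A(t) = ∑_{x ≠ y} a_{xy} N_{xy}(t)`. -/
def observable {Ω : Type*} (a : E → E → ℝ) (X : ℝ≥0 → Ω → E) (t : ℝ≥0) (ω : Ω) : ℝ :=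
  ∑ x, ∑ y with y ≠ x, a x y * jumpCount (fun s => X s ω) x y t

end JumpChain

end

/-! Write W for the generator, Q = |-⟩⟨p|, G for the pseudoinverse, b for `a` with its diagonal set
to zero. Discretize: with h = t/n, let S_n = ∑_{k<n} b(X_{kh}, X_{(k+1)h}) (`gridSum`). A càdlàg
path in a discrete space has finitely many jumps in (0, t], so once the mesh is below the smallest
gap between them, S_n equals A(t) (`IsCadlag.eventually_gridSum_eq`). Moreover |S_n| ≤ C·N with N
the total number of jumps, and N is in L² by Fatou; dominated convergence then makes the first two
moments of A(t) limits of those of S_n.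

Put P = e^{hW} and let J_a(M) be the entrywise product of M with b. The finite-dimensional laws and
stationarity give E S_n = n⟨p|J_a(P)|-⟩ and E S_n² = n⟨p|J_{a²}(P)|-⟩ + 2⟨p|J_a(P) (∑_{m<n} ∑_{i<m}
P^i) J_a(P)|-⟩. Here J_a(P)/h → J_a(W) = W'_0, and h² times the double sum tends to (e^{tW} - 1)G² -
tG + (t²/2)Q (`tendsto_sq_smul_sum_geom`). The rank-one Q term contributes exactly (E A(t))², which
cancels in the variance.

After division by t, only (e^{tW} - 1)/t still depends on t. It tends to 0 at infinity, because
e^{tW} stays bounded, and to W at 0, where WG² = G cancels the correction. -/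

noncomputable section

namespace JumpChain

variable {E : Type*} [Fintype E] [DecidableEq E]

/-! ### Matrix exponentials and geometric sums. -/

section MatrixExp

theorem hasSum_exp_matrix (A : Matrix E E ℝ) :
    HasSum (fun n : ℕ => ((n.factorial : ℝ)⁻¹) • A ^ n) (NormedSpace.exp A) := by
  let _ := Matrix.linftyOpNormedRing (n := E) (α := ℝ)
  let _ := Matrix.linftyOpNormedAlgebra (n := E) (R := ℝ) (α := ℝ)
  exact NormedSpace.exp_series_hasSum_exp' (𝕂 := ℝ) A

theorem mul_exp_of_mul_eq_zero {Q A : Matrix E E ℝ} (h : Q * A = 0) :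
    Q * NormedSpace.exp A = Q := by
  have h1 := (hasSum_exp_matrix A).mul_left Q
  have h2 : HasSum (fun n : ℕ => Q * (((n.factorial : ℝ)⁻¹) • A ^ n)) Q := by
    convert hasSum_single (f := fun n : ℕ => Q * (((n.factorial : ℝ)⁻¹) • A ^ n)) 0 ?_ using 1
    · simp
    · intro n hn
      obtain ⟨m, rfl⟩ := Nat.exists_eq_succ_of_ne_zero hn
      simp [pow_succ', ← mul_assoc, h]
  exact h1.unique h2

theorem exp_mul_of_mul_eq_zero {Q A : Matrix E E ℝ} (h : A * Q = 0) :
    NormedSpace.exp A * Q = Q := by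
  have h1 := (hasSum_exp_matrix A).mul_right Q
  have h2 : HasSum (fun n : ℕ => (((n.factorial : ℝ)⁻¹) • A ^ n) * Q) Q := by
    convert hasSum_single (f := fun n : ℕ => (((n.factorial : ℝ)⁻¹) • A ^ n) * Q) 0 ?_ using 1
    · simp
    · intro n hn
      obtain ⟨m, rfl⟩ := Nat.exists_eq_succ_of_ne_zero hn
      simp [pow_succ, mul_assoc, h]
  exact h1.unique h2

theorem tendsto_slope_exp (A : Matrix E E ℝ) :
    Tendsto (fun h : ℝ => h⁻¹ • (NormedSpace.exp (h • A) - 1)) (𝓝[≠] 0) (𝓝 A) := by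
  let _ := Matrix.linftyOpNormedRing (n := E) (α := ℝ)
  let _ := Matrix.linftyOpNormedAlgebra (n := E) (R := ℝ) (α := ℝ)
  have h := (hasDerivAt_exp_smul_const (𝕂 := ℝ) A 0).tendsto_slope_zero
  simp only [zero_add, zero_smul, NormedSpace.exp_zero, one_mul] at h
  exact h

theorem tendsto_inv_of_isUnit {ι : Type*} {l : Filter ι} {f : ι → Matrix E E ℝ}
    {A : Matrix E E ℝ} (hA : IsUnit A) (hf : Tendsto f l (𝓝 A)) :
    (∀ᶠ i in l, IsUnit (f i)) ∧ Tendsto (fun i => (f i)⁻¹) l (𝓝 A⁻¹) := by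
  let _ := Matrix.linftyOpNormedRing (n := E) (α := ℝ)
  let _ := Matrix.linftyOpNormedAlgebra (n := E) (R := ℝ) (α := ℝ)
  obtain ⟨u, rfl⟩ := hA
  refine ⟨hf.eventually (Units.isOpen.mem_nhds u.isUnit), ?_⟩
  simp only [Matrix.nonsing_inv_eq_ringInverse]
  exact (NormedRing.inverse_continuousAt u).tendsto.comp hf

theorem tendsto_grid {t : ℝ} (ht : 0 < t) : Tendsto (fun n : ℕ => t / n) atTop (𝓝[≠] 0) := by
  refine tendsto_nhdsWithin_iff.2 ⟨tendsto_const_div_atTop_nhds_zero_nat t, ?_⟩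
  filter_upwards [eventually_gt_atTop 0] with n hn
  exact (div_pos ht (by exact_mod_cast hn)).ne'

/-- One factor P - 1 telescopes the inner sum to P^m - 1, the other telescopes the outer one. -/
theorem sum_geom_mul_sub_one_sq {R : Type*} [Ring R] (P : R) (n : ℕ) :
    (∑ m ∈ Finset.range n, ∑ i ∈ Finset.range m, P ^ i) * (P - 1) ^ 2 =
      P ^ n - 1 - n * (P - 1) := by
  rw [pow_two, ← mul_assoc, Finset.sum_mul]
  simp only [geom_sum_mul, Finset.sum_sub_distrib, sub_mul, Finset.sum_const, Finset.card_range,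
    nsmul_eq_mul, mul_one]

/-- The complementary case: on the range of Q nothing telescopes and every power of P acts as the
identity. -/
theorem mul_sum_geom {R : Type*} [Ring R] {Q P : R} (h : P * Q = Q) (n : ℕ) :
    (∑ m ∈ Finset.range n, ∑ i ∈ Finset.range m, P ^ i) * Q =
      (∑ m ∈ Finset.range n, (m : R)) * Q := by
  have hp : ∀ i : ℕ, P ^ i * Q = Q := by
    intro i
    induction i with
    | zero => simp
    | succ i ih => rw [pow_succ, mul_assoc, h, ih]
  simp only [Finset.sum_mul, hp, Finset.sum_const, Finset.card_range, nsmul_eq_mul]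

theorem cast_sum_range (n : ℕ) :
    ∑ m ∈ Finset.range n, (m : ℝ) = (n : ℝ) * (n - 1) / 2 := by
  induction n with
  | zero => simp
  | succ n ih => rw [Finset.sum_range_succ, ih]; push_cast; ring

end MatrixExp

/-! ### Kernel of the generator, invertibility of W + Q, positivity of the stationary law. -/

section Generator

variable {w : E → E → ℝ} {p : E → ℝ}

theorem generator_mulVec (w : E → E → ℝ) (v : E → ℝ) (x : E) :
    (generator w *ᵥ v) x = ∑ y with y ≠ x, w x y * (v y - v x) := by
  simp only [Matrix.mulVec, dotProduct, generator, Matrix.of_apply]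
  rw [← Finset.sum_filter_add_sum_filter_not Finset.univ (fun y => y ≠ x)]
  have h1 : ∑ y with y ≠ x, (if x = y then -∑ z with z ≠ x, w x z else w x y) * v y =
      ∑ y with y ≠ x, w x y * v y := by
    refine Finset.sum_congr rfl fun y hy => ?_
    rw [if_neg (Ne.symm (Finset.mem_filter.1 hy).2)]
  have h2 : (Finset.univ.filter fun y => ¬ y ≠ x) = {x} := by ext; simp
  rw [h1, h2, Finset.sum_singleton, if_pos rfl]
  simp only [mul_sub, Finset.sum_sub_distrib, Finset.sum_mul, neg_mul]
  ring

theorem generator_mulVec_one (w : E → E → ℝ) : generator w *ᵥ 1 = 0 := by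
  ext x; simp [generator_mulVec]

theorem generator_mul_oneProj (w : E → E → ℝ) (p : E → ℝ) : generator w * oneProj p = 0 := by
  rw [oneProj, Matrix.mul_vecMulVec, generator_mulVec_one]
  ext; simp [Matrix.vecMulVec_apply]

theorem IsStationary.oneProj_mul_generator (hp : IsStationary w p) :
    oneProj p * generator w = 0 := by
  rw [oneProj, Matrix.vecMulVec_mul, hp.vecMul_generator]
  ext; simp [Matrix.vecMulVec_apply]

theorem IsStationary.oneProj_mul_self (hp : IsStationary w p) :
    oneProj p * oneProj p = oneProj p := by
  rw [oneProj, Matrix.vecMulVec_mul_vecMulVec]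
  simp [dotProduct, hp.sum_eq_one]

theorem IsStationary.vecMul_oneProj (hp : IsStationary w p) : p ᵥ* oneProj p = p := by
  ext x
  simp [oneProj, Matrix.vecMul, dotProduct, Matrix.vecMulVec_apply, ← Finset.sum_mul,
    hp.sum_eq_one]

theorem IsStationary.vecMul_exp (hp : IsStationary w p) (s : ℝ) :
    p ᵥ* NormedSpace.exp (s • generator w) = p := by
  have h : oneProj p * NormedSpace.exp (s • generator w) = oneProj p :=
    mul_exp_of_mul_eq_zero (by rw [mul_smul_comm, hp.oneProj_mul_generator, smul_zero])
  conv_lhs => rw [← hp.vecMul_oneProj]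
  rw [Matrix.vecMul_vecMul, h, hp.vecMul_oneProj]

theorem exp_mul_oneProj (s : ℝ) :
    NormedSpace.exp (s • generator w) * oneProj p = oneProj p :=
  exp_mul_of_mul_eq_zero (by rw [smul_mul_assoc, generator_mul_oneProj, smul_zero])

/-- Maximum principle: at a maximizer the nonnegative terms w(b, y)(v b - v y) sum to zero, so the
maximum propagates along every edge of positive rate. -/
theorem eq_of_generator_mulVec_eq_zero (hw : ∀ x y, x ≠ y → 0 ≤ w x y)
    (hirr : IsIrreducible w) {v : E → ℝ} (hv : generator w *ᵥ v = 0) (x y : E) : v x = v y := by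
  have : Nonempty E := ⟨x⟩
  obtain ⟨m, hm⟩ := Finite.exists_max v
  have key : ∀ z, v z = v m := by
    intro z
    have hr := hirr m z
    induction hr with
    | refl => rfl
    | @tail b c _ hbc ih =>
      have h0 : ∑ y with y ≠ b, w b y * (v b - v y) = 0 := by
        have := generator_mulVec w v b
        rw [hv] at this
        simp only [Pi.zero_apply] at this
        rw [← neg_eq_zero, ← Finset.sum_neg_distrib, this]
        exact Finset.sum_congr rfl fun y _ => by ring
      have h1 := (Finset.sum_eq_zero_iff_of_nonneg (fun y hy =>
        mul_nonneg (hw b y (Ne.symm (Finset.mem_filter.1 hy).2))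
          (by rw [ih]; linarith [hm y]))).1 h0 c (by simp [Ne.symm hbc.1])
      rcases mul_eq_zero.1 h1 with h | h
      · exact absurd h hbc.2.ne'
      · linarith
  rw [key x, key y]

/-- If (W + Q)v = 0, multiplying by Q gives Qv = 0, hence Wv = 0; v is then constant, and its mean
under p vanishes. -/
theorem IsStationary.isUnit_generator_add_oneProj (hp : IsStationary w p)
    (hw : ∀ x y, x ≠ y → 0 ≤ w x y) (hirr : IsIrreducible w) :
    IsUnit (generator w + oneProj p) := by
  rw [← Matrix.mulVec_injective_iff_isUnit]
  suffices h : ∀ v, (generator w + oneProj p) *ᵥ v = 0 → v = 0 by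
    intro u v huv
    have := h (u - v) (by rw [Matrix.mulVec_sub]; exact sub_eq_zero.2 huv)
    exact sub_eq_zero.1 this
  intro v hv
  have hQ : oneProj p *ᵥ v = 0 := by
    have : oneProj p *ᵥ ((generator w + oneProj p) *ᵥ v) = oneProj p *ᵥ v := by
      rw [Matrix.mulVec_mulVec, mul_add, hp.oneProj_mul_generator, hp.oneProj_mul_self, zero_add]
    rw [← this, hv, Matrix.mulVec_zero]
  have hW : generator w *ᵥ v = 0 := by
    rw [Matrix.add_mulVec, hQ, add_zero] at hv; exact hv
  ext x
  have hc : ∀ y, v y = v x := fun y => eq_of_generator_mulVec_eq_zero hw hirr hW y x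
  have := congrFun hQ x
  simpa [oneProj, Matrix.mulVec, dotProduct, Matrix.vecMulVec_apply, hc, ← Finset.sum_mul,
    hp.sum_eq_one] using this

/-- A zero of p propagates backwards along edges: if p c = 0, stationarity at c is a vanishing sum
of nonnegative inflows. -/
theorem IsStationary.pos (hp : IsStationary w p) (hw : ∀ x y, x ≠ y → 0 ≤ w x y)
    (hirr : IsIrreducible w) (x : E) : 0 < p x := by
  refine lt_of_le_of_ne (hp.nonneg x) fun h0 => ?_
  have key : ∀ z, p z = 0 := by
    intro z
    have hr := hirr z x
    induction hr using Relation.ReflTransGen.head_induction_on with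
    | refl => exact h0.symm
    | @head b c hbc _ ih =>
      have h1 := congrFun hp.vecMul_generator c
      simp only [Matrix.vecMul, dotProduct, Pi.zero_apply] at h1
      have h2 := (Finset.sum_eq_zero_iff_of_nonneg (fun y _ => ?_)).1 h1 b (Finset.mem_univ b)
      · simp only [generator, Matrix.of_apply, if_neg hbc.1] at h2
        exact (mul_eq_zero.1 h2).resolve_right hbc.2.ne'
      · by_cases hy : y = c
        · simp [hy, ih]
        · exact mul_nonneg (hp.nonneg y) (by
            simp only [generator, Matrix.of_apply, if_neg hy]; exact hw y c hy)
  have := hp.sum_eq_one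
  simp [key] at this

end Generator

/-! ### Pseudoinverse identities and the limit of the double geometric sum. -/

section Pseudoinverse

variable {w : E → E → ℝ} {p : E → ℝ}

theorem pseudoinverse_identities (hp : IsStationary w p)
    (hu : IsUnit (generator w + oneProj p)) :
    generator w * pseudoinverse w p = 1 - oneProj p ∧
    (generator w + oneProj p)⁻¹ * oneProj p = oneProj p ∧
    oneProj p * (generator w + oneProj p)⁻¹ = oneProj p ∧
    (generator w + oneProj p)⁻¹ * generator w = 1 - oneProj p := by
  have hd := (Matrix.isUnit_iff_isUnit_det _).1 hu
  set W := generator w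
  set Q := oneProj p
  have hWQ : W * Q = 0 := generator_mul_oneProj w p
  have hQW : Q * W = 0 := hp.oneProj_mul_generator
  have hQQ : Q * Q = Q := hp.oneProj_mul_self
  have h1 : (W + Q) * (W + Q)⁻¹ = 1 := Matrix.mul_nonsing_inv _ hd
  have h2 : (W + Q)⁻¹ * (W + Q) = 1 := Matrix.nonsing_inv_mul _ hd
  have hRQ : (W + Q)⁻¹ * Q = Q := by
    have : (W + Q)⁻¹ * ((W + Q) * Q) = Q := by rw [← mul_assoc, h2, one_mul]
    rwa [add_mul, hWQ, hQQ, zero_add] at this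
  have hQR : Q * (W + Q)⁻¹ = Q := by
    have : (Q * (W + Q)) * (W + Q)⁻¹ = Q := by rw [mul_assoc, h1, mul_one]
    rwa [mul_add, hQW, hQQ, zero_add] at this
  refine ⟨?_, hRQ, hQR, ?_⟩
  · rw [pseudoinverse, mul_sub, hWQ, sub_zero, eq_sub_iff_add_eq]
    rw [add_mul, hQR] at h1
    exact h1
  · rw [eq_sub_iff_add_eq]
    rwa [mul_add, hRQ] at h2

theorem generator_mul_pseudoinverse_sq (hp : IsStationary w p)
    (hu : IsUnit (generator w + oneProj p)) :
    generator w * pseudoinverse w p ^ 2 = pseudoinverse w p := by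
  obtain ⟨h1, -, h3, -⟩ := pseudoinverse_identities hp hu
  rw [pow_two, ← mul_assoc, h1, sub_mul, one_mul]
  conv_lhs => rw [pseudoinverse, mul_sub, h3, hp.oneProj_mul_self, sub_self]
  rw [sub_zero, pseudoinverse]

/-- Since (W + Q)⁻¹ = G + Q with GQ = QG = 0, its square is G² + Q; the left side is the form in
which the grid limit arises. -/
theorem correlation_limit_eq (hp : IsStationary w p)
    (hu : IsUnit (generator w + oneProj p)) (t : ℝ) :
    (NormedSpace.exp (t • generator w) - 1 - t • generator w + (t ^ 2 / 2) • oneProj p) *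
      (generator w + oneProj p)⁻¹ ^ 2 =
    (NormedSpace.exp (t • generator w) - 1) * pseudoinverse w p ^ 2 - t • pseudoinverse w p +
      (t ^ 2 / 2) • oneProj p := by
  obtain ⟨h1, h2, h3, -⟩ := pseudoinverse_identities hp hu
  have hQQ := hp.oneProj_mul_self
  have hG := generator_mul_pseudoinverse_sq hp hu
  have hE : (NormedSpace.exp (t • generator w) - 1) * oneProj p = 0 := by
    rw [sub_mul, exp_mul_oneProj, one_mul, sub_self]
  have hWQ := generator_mul_oneProj w p
  have hR : (generator w + oneProj p)⁻¹ ^ 2 = pseudoinverse w p ^ 2 + oneProj p := by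
    rw [pseudoinverse, pow_two, pow_two, sub_mul, mul_sub, mul_sub, h2, h3, hQQ]
    abel
  have hQG : oneProj p * pseudoinverse w p ^ 2 = 0 := by
    have hQG' : oneProj p * pseudoinverse w p = 0 := by
      rw [pseudoinverse, mul_sub, h3, hQQ, sub_self]
    rw [pow_two, ← mul_assoc, hQG', zero_mul]
  rw [hR, mul_add, add_mul, sub_mul _ (t • generator w), smul_mul_assoc, smul_mul_assoc, hG, hQG,
    add_mul, sub_mul _ (t • generator w), hE, smul_mul_assoc, smul_mul_assoc, hWQ, hQQ]
  simp

/-- The rescaled double geometric sum over a grid of mesh `t / n` converges. -/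
theorem tendsto_sq_smul_sum_geom (hp : IsStationary w p)
    (hu : IsUnit (generator w + oneProj p)) {t : ℝ} (ht : 0 < t) :
    Tendsto (fun n : ℕ => (t / n) ^ 2 • ∑ m ∈ Finset.range n, ∑ i ∈ Finset.range m,
        NormedSpace.exp ((t / n) • generator w) ^ i) atTop
      (𝓝 ((NormedSpace.exp (t • generator w) - 1) * pseudoinverse w p ^ 2 -
        t • pseudoinverse w p + (t ^ 2 / 2) • oneProj p)) := by
  have hK := (tendsto_slope_exp (generator w)).comp (tendsto_grid ht)
  have hKQ := hK.add_const (oneProj p)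
  obtain ⟨hunit, hinv⟩ := tendsto_inv_of_isUnit hu hKQ
  rw [← correlation_limit_eq hp hu t]
  -- This is h² · n(n - 1)/2, the weight of Q in the rescaled double sum.
  have hc : Tendsto (fun n : ℕ => t ^ 2 / 2 * (1 - 1 / (n : ℝ))) atTop (𝓝 (t ^ 2 / 2)) := by
    have := (tendsto_const_nhds (x := (1 : ℝ))).sub (tendsto_const_div_atTop_nhds_zero_nat (1 : ℝ))
    simpa using this.const_mul (t ^ 2 / 2)
  have hlim := (((tendsto_const_nhds (x := NormedSpace.exp (t • generator w) - 1)).sub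
    (hK.const_smul t)).add (hc.smul_const (oneProj p))).mul (hinv.pow 2)
  refine hlim.congr' ?_
  filter_upwards [hunit, eventually_gt_atTop 0] with n hn hn0
  have hn0' : (n : ℝ) ≠ 0 := by exact_mod_cast hn0.ne'
  have hd := (Matrix.isUnit_iff_isUnit_det _).1 hn
  simp only [Function.comp] at hn hd ⊢
  have hP : NormedSpace.exp ((t / n) • generator w) ^ n = NormedSpace.exp (t • generator w) := by
    rw [← Matrix.exp_nsmul, ← Nat.cast_smul_eq_nsmul ℝ, smul_smul, mul_div_cancel₀ _ hn0']
  have hPQ : NormedSpace.exp ((t / n) • generator w) * oneProj p = oneProj p := exp_mul_oneProj _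
  have hQP : oneProj p * NormedSpace.exp ((t / n) • generator w) = oneProj p :=
    mul_exp_of_mul_eq_zero (by rw [mul_smul_comm, hp.oneProj_mul_generator, smul_zero])
  set P := NormedSpace.exp ((t / n) • generator w)
  set Q := oneProj p
  have hQQ : Q * Q = Q := hp.oneProj_mul_self
  set K := (t / (n : ℝ))⁻¹ • (P - 1) with hKdef
  -- K kills constants, so one cannot divide by K². Adding Q yields a matrix invertible for large n,
  -- and KQ = QK = 0 leaves no cross terms.
  have hsq : (K + Q) ^ 2 = K ^ 2 + Q := by
    have e1 : K * Q = 0 := by rw [hKdef, smul_mul_assoc, sub_mul, hPQ, one_mul, sub_self, smul_zero]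
    have e2 : Q * K = 0 := by rw [hKdef, mul_smul_comm, mul_sub, hQP, mul_one, sub_self, smul_zero]
    rw [pow_two, add_mul, mul_add, mul_add, e1, e2, hQQ, pow_two]
    abel
  have hT : ((t / n) ^ 2 • ∑ m ∈ Finset.range n, ∑ i ∈ Finset.range m, P ^ i) * (K + Q) ^ 2 =
      NormedSpace.exp (t • generator w) - 1 - t • K + (t ^ 2 / 2 * (1 - 1 / (n : ℝ))) • Q := by
    rw [hsq, mul_add, smul_mul_assoc, smul_mul_assoc, mul_sum_geom hPQ, hKdef, smul_pow,
      mul_smul_comm, sum_geom_mul_sub_one_sq, hP, smul_smul]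
    have e3 : (∑ m ∈ Finset.range n, (m : Matrix E E ℝ)) * Q = ((n : ℝ) * (n - 1) / 2) • Q := by
      rw [← cast_sum_range, Finset.sum_mul, Finset.sum_smul]
      refine Finset.sum_congr rfl fun m _ => ?_
      rw [← nsmul_eq_mul, Nat.cast_smul_eq_nsmul]
    have e4 : (n : Matrix E E ℝ) * (P - 1) = (n : ℝ) • (P - 1) := by
      rw [← nsmul_eq_mul, Nat.cast_smul_eq_nsmul]
    rw [e3, e4, smul_smul, smul_smul]
    have c1 : (t / (n : ℝ)) ^ 2 * (t / (n : ℝ))⁻¹ ^ 2 = 1 := by field_simp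
    have c2 : t * (t / (n : ℝ))⁻¹ = n := by field_simp
    have c3 : (t / (n : ℝ)) ^ 2 * ((n : ℝ) * (n - 1) / 2) = t ^ 2 / 2 * (1 - 1 / (n : ℝ)) := by
      field_simp
    rw [c1, c2, c3, one_smul]
  have hone : (K + Q) ^ 2 * (K + Q)⁻¹ ^ 2 = 1 := by
    rw [pow_two, pow_two, mul_assoc, ← mul_assoc (K + Q) (K + Q)⁻¹, Matrix.mul_nonsing_inv _ hd,
      one_mul, Matrix.mul_nonsing_inv _ hd]
  rw [← hT, mul_assoc, hone, mul_one]

end Pseudoinverse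

end JumpChain

end

noncomputable section

namespace JumpChain

variable {E : Type*}

/-! ### Càdlàg paths: finitely many jumps, and recovery of the jump sum from a grid. -/

section Paths

/-- A path is càdlàg for the discrete topology of the state space. -/
structure IsCadlag {E : Type*} (f : ℝ≥0 → E) : Prop where
  right : ∀ t : ℝ≥0, ∀ᶠ s in 𝓝[>] t, f s = f t
  left : ∀ t : ℝ≥0, 0 < t → ∃ x, ∀ᶠ s in 𝓝[<] t, f s = x

open Classical in
/-- The left limit of a path at `s`, and the value at `s` if there is none. -/
def leftVal {E : Type*} (f : ℝ≥0 → E) (s : ℝ≥0) : E :=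
  if h : ∃ x, ∀ᶠ r in 𝓝[<] s, f r = x then h.choose else f s

/-- The times in `(0, t]` at which the path jumps. -/
def jumpTimes {E : Type*} (f : ℝ≥0 → E) (t : ℝ≥0) : Set ℝ≥0 :=
  {s | 0 < s ∧ s ≤ t ∧ leftVal f s ≠ f s}

variable {f : ℝ≥0 → E} {t : ℝ≥0}

theorem IsCadlag.eventually_eq_leftVal (hf : IsCadlag f) {s : ℝ≥0} (hs : 0 < s) :
    ∀ᶠ r in 𝓝[<] s, f r = leftVal f s := by
  have h := hf.left s hs
  rw [leftVal, dif_pos h]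
  exact h.choose_spec

theorem neBot_nhdsLT {s : ℝ≥0} (hs : 0 < s) : (𝓝[<] s).NeBot :=
  nhdsLT_neBot_of_exists_lt ⟨0, hs⟩

theorem IsCadlag.leftVal_eq_iff (hf : IsCadlag f) {s : ℝ≥0} (hs : 0 < s) (x : E) :
    leftVal f s = x ↔ ∀ᶠ r in 𝓝[<] s, f r = x := by
  constructor
  · rintro rfl
    exact hf.eventually_eq_leftVal hs
  · intro h
    have := neBot_nhdsLT hs
    obtain ⟨r, h1, h2⟩ := (h.and (hf.eventually_eq_leftVal hs)).exists
    rw [← h2, h1]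

/-- Infinitely many jump times would accumulate in the compact [0, t], but the path is constant on a
small punctured neighbourhood on either side of any point. -/
theorem IsCadlag.finite_jumpTimes (hf : IsCadlag f) (t : ℝ≥0) : (jumpTimes f t).Finite := by
  by_contra hinf
  obtain ⟨x, hx, hacc⟩ := Set.Infinite.exists_accPt_of_subset_isCompact hinf
    (isCompact_Icc (a := (0 : ℝ≥0)) (b := t)) fun s hs => ⟨hs.1.le, hs.2.1⟩
  rw [accPt_iff_frequently_nhdsNE] at hacc
  apply hacc
  rw [← nhdsLT_sup_nhdsGT, eventually_sup]
  constructor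
  · rcases eq_or_lt_of_le (zero_le (a := x)) with h0 | h0
    · have : Set.Iio x = ∅ := by ext y; simp [← h0]
      simp [this]
    · have h1 := hf.eventually_eq_leftVal h0
      obtain ⟨l, hl, hl'⟩ := (mem_nhdsLT_iff_exists_Ioo_subset' h0).1 h1
      filter_upwards [Ioo_mem_nhdsLT hl] with s hs hsJ
      refine hsJ.2.2 ?_
      rw [hf.leftVal_eq_iff hsJ.1, hl' hs]
      filter_upwards [Ioo_mem_nhdsLT hs.1] with r hr
      exact hl' ⟨hr.1, hr.2.trans hs.2⟩
  · obtain ⟨l, hl, hl'⟩ := (mem_nhdsGT_iff_exists_Ioo_subset).1 (hf.right x)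
    filter_upwards [Ioo_mem_nhdsGT hl] with s hs hsJ
    refine hsJ.2.2 ?_
    rw [hf.leftVal_eq_iff hsJ.1, hl' hs]
    filter_upwards [Ioo_mem_nhdsLT hs.1] with r hr
    exact hl' ⟨hr.1, hr.2.trans hs.2⟩

/-- Without jumps the path is continuous on [u, v] into a discrete space, hence constant by
connectedness. -/
theorem IsCadlag.eq_of_no_jump (hf : IsCadlag f) {u v : ℝ≥0} (huv : u ≤ v)
    (h : ∀ s, u < s → s ≤ v → leftVal f s = f s) : f u = f v := by
  let _ : TopologicalSpace E := ⊥
  have : DiscreteTopology E := ⟨rfl⟩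
  have hc : ContinuousOn f (Set.Icc u v) := by
    intro s hs
    rw [ContinuousWithinAt, nhds_discrete, tendsto_pure]
    have hge : ∀ᶠ r in 𝓝[≥] s, f r = f s := by
      rw [← Set.Ioi_insert, nhdsWithin_insert, eventually_sup]
      exact ⟨rfl, hf.right s⟩
    rcases eq_or_lt_of_le hs.1 with rfl | hlt
    · exact nhdsWithin_mono _ (fun r hr => hr.1) hge
    · have hs0 : 0 < s := zero_le.trans_lt hlt
      have hlt' : ∀ᶠ r in 𝓝[<] s, f r = f s := (hf.leftVal_eq_iff hs0 _).1 (h s hlt hs.2)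
      refine mem_nhdsWithin_of_mem_nhds ?_
      change ∀ᶠ r in 𝓝 s, f r = f s
      rw [← nhdsLT_sup_nhdsGE, eventually_sup]
      exact ⟨hlt', hge⟩
  exact isPreconnected_Icc.constant hc (Set.left_mem_Icc.2 huv) (Set.right_mem_Icc.2 huv)

/-- The increment of a path functional over a cell that contains at most one jump. -/
theorem IsCadlag.cell_eq_sum (hf : IsCadlag f) {J : Finset ℝ≥0} (hJ : ↑J = jumpTimes f t)
    {b : E → E → ℝ} (hb : ∀ x, b x x = 0) {u v : ℝ≥0} (huv : u ≤ v) (hvt : v ≤ t)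
    (h1 : ∀ s ∈ J, ∀ s' ∈ J, u < s → s < s' → s' ≤ v → False) :
    b (f u) (f v) = ∑ s ∈ J with u < s ∧ s ≤ v, b (leftVal f s) (f s) := by
  have hmem : ∀ s, s ∈ J ↔ 0 < s ∧ s ≤ t ∧ leftVal f s ≠ f s := fun s => by
    rw [← Finset.mem_coe, hJ]; rfl
  have hno : ∀ s, u < s → s ≤ v → s ∉ J → leftVal f s = f s := by
    intro s hs hs' hn
    by_contra hne
    exact hn ((hmem s).2 ⟨zero_le.trans_lt hs, hs'.trans hvt, hne⟩)
  rcases (J.filter fun s => u < s ∧ s ≤ v).eq_empty_or_nonempty with he | ⟨s, hs⟩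
  · rw [he, Finset.sum_empty, hf.eq_of_no_jump huv, hb]
    intro s hs hs'
    refine hno s hs hs' fun hsJ => ?_
    have : s ∈ J.filter fun s => u < s ∧ s ≤ v := Finset.mem_filter.2 ⟨hsJ, hs, hs'⟩
    rw [he] at this
    exact absurd this (Finset.notMem_empty s)
  · obtain ⟨hsJ, hus, hsv⟩ := Finset.mem_filter.1 hs
    have hs0 : 0 < s := zero_le.trans_lt hus
    have huniq : J.filter (fun s => u < s ∧ s ≤ v) = {s} := by
      refine Finset.eq_singleton_iff_unique_mem.2 ⟨hs, fun r hr => ?_⟩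
      obtain ⟨hrJ, hur, hrv⟩ := Finset.mem_filter.1 hr
      rcases lt_trichotomy r s with h | h | h
      · exact (h1 r hrJ s hsJ hur h hsv).elim
      · exact h
      · exact (h1 s hsJ r hrJ hus h hrv).elim
    have hnot : ∀ r, u < r → r ≤ v → r ≠ s → r ∉ J := by
      intro r hr hr' hrs hrJ
      have : r ∈ J.filter fun s => u < s ∧ s ≤ v := Finset.mem_filter.2 ⟨hrJ, hr, hr'⟩
      rw [huniq, Finset.mem_singleton] at this
      exact hrs this
    rw [huniq, Finset.sum_singleton]
    have hv : f s = f v := hf.eq_of_no_jump hsv fun r hr hr' =>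
      hno r (hus.trans hr) hr' (hnot r (hus.trans hr) hr' hr.ne')
    have hu : leftVal f s = f u := by
      have := neBot_nhdsLT hs0
      obtain ⟨r, hr, hr'⟩ :=
        ((hf.eventually_eq_leftVal hs0).and (Ioo_mem_nhdsLT hus)).exists
      rw [← hr]
      refine (hf.eq_of_no_jump hr'.1.le fun q hq hq' => ?_).symm
      have hqs := hq'.trans_lt hr'.2
      exact hno q hq (hqs.le.trans hsv) (hnot q hq (hqs.le.trans hsv) hqs.ne)
    rw [hu, hv]

theorem sum_cells {J : Finset ℝ≥0} {τ : ℕ → ℝ≥0} (hτ : Monotone τ)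
    (h0 : ∀ s ∈ J, τ 0 < s) (g : ℝ≥0 → ℝ) (n : ℕ) :
    ∑ k ∈ Finset.range n, ∑ s ∈ J with τ k < s ∧ s ≤ τ (k + 1), g s =
      ∑ s ∈ J with s ≤ τ n, g s := by
  induction n with
  | zero =>
    rw [Finset.sum_range_zero, Finset.filter_false_of_mem, Finset.sum_empty]
    exact fun s hs => not_le.2 (h0 s hs)
  | succ n ih =>
    rw [Finset.sum_range_succ, ih, ← Finset.sum_union]
    · congr 1
      ext s
      simp only [Finset.mem_union, Finset.mem_filter]
      have := hτ (Nat.le_succ n)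
      constructor
      · rintro (⟨h, h'⟩ | ⟨h, -, h'⟩)
        · exact ⟨h, h'.trans this⟩
        · exact ⟨h, h'⟩
      · rintro ⟨h, h'⟩
        rcases le_or_gt s (τ n) with h2 | h2
        · exact Or.inl ⟨h, h2⟩
        · exact Or.inr ⟨h, h2, h'⟩
    · rw [Finset.disjoint_filter]
      exact fun s _ h h' => absurd h (not_le.2 h'.1)

/-- The discretization of a path functional along the grid of mesh `t / n`. -/
def gridSum {E : Type*} (b : E → E → ℝ) (f : ℝ≥0 → E) (t : ℝ≥0) (n : ℕ) : ℝ :=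
  ∑ k ∈ Finset.range n, b (f (k * (t / n))) (f ((k + 1 : ℕ) * (t / n)))

/-- The coefficients `a` with the diagonal set to zero. -/
def offDiag {E : Type*} [DecidableEq E] (a : E → E → ℝ) (x y : E) : ℝ :=
  if x = y then 0 else a x y

theorem IsCadlag.sum_jumpCount [Fintype E] [DecidableEq E] (hf : IsCadlag f) {J : Finset ℝ≥0} (hJ : ↑J = jumpTimes f t)
    (a : E → E → ℝ) :
    ∑ x, ∑ y with y ≠ x, a x y * jumpCount f x y t =
      ∑ s ∈ J, offDiag a (leftVal f s) (f s) := by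
  have hmem : ∀ s, s ∈ J ↔ 0 < s ∧ s ≤ t ∧ leftVal f s ≠ f s := fun s => by
    rw [← Finset.mem_coe, hJ]; rfl
  have hcount : ∀ x y, y ≠ x →
      jumpCount f x y t = (J.filter fun s => leftVal f s = x ∧ f s = y).card := by
    intro x y hxy
    rw [jumpCount, ← Set.ncard_coe_finset]
    congr 1
    ext s
    simp only [Set.mem_ofPred_eq, Finset.coe_filter, hmem]
    constructor
    · rintro ⟨h0, h1, h2, h3⟩
      have := (hf.leftVal_eq_iff h0 x).2 h2
      exact ⟨⟨h0, h1, by rw [this, h3]; exact hxy.symm⟩, this, h3⟩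
    · rintro ⟨⟨h0, h1, -⟩, h2, h3⟩
      exact ⟨h0, h1, (hf.leftVal_eq_iff h0 x).1 h2, h3⟩
  calc ∑ x, ∑ y with y ≠ x, a x y * jumpCount f x y t
      = ∑ x, ∑ y, ∑ s ∈ J, if leftVal f s = x ∧ f s = y then offDiag a x y else 0 := by
        refine Finset.sum_congr rfl fun x _ => ?_
        rw [Finset.sum_filter]
        refine Finset.sum_congr rfl fun y _ => ?_
        rw [← Finset.sum_filter, Finset.sum_const, nsmul_eq_mul]
        split_ifs with h
        · rw [hcount x y h, offDiag, if_neg h.symm, mul_comm]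
        · rw [offDiag, if_pos (not_not.1 h).symm, mul_zero]
    _ = ∑ s ∈ J, ∑ x, ∑ y, if leftVal f s = x ∧ f s = y then offDiag a x y else 0 := by
        rw [Finset.sum_comm (s := J)]
        exact Finset.sum_congr rfl fun x _ => Finset.sum_comm
    _ = _ := by
        refine Finset.sum_congr rfl fun s _ => ?_
        simp [ite_and]

theorem monotone_grid (h : ℝ≥0) : Monotone fun k : ℕ => (k : ℝ≥0) * h :=
  fun _ _ hij => mul_le_mul_left (Nat.cast_le.2 hij) h

theorem grid_le {n k : ℕ} (hk : k < n) (t : ℝ≥0) : ((k + 1 : ℕ) : ℝ≥0) * (t / n) ≤ t := by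
  have hn : (n : ℝ≥0) ≠ 0 := by exact_mod_cast (Nat.zero_le k).trans_lt hk |>.ne'
  calc ((k + 1 : ℕ) : ℝ≥0) * (t / n) ≤ n * (t / n) := monotone_grid (t / n) hk
    _ = t := mul_div_cancel₀ t hn

theorem sum_grid_cells {J : Finset ℝ≥0} (hJ : ↑J = jumpTimes f t) (g : ℝ≥0 → ℝ) {n : ℕ}
    (hn : n ≠ 0) :
    ∑ k ∈ Finset.range n, ∑ s ∈ J with k * (t / n) < s ∧ s ≤ (k + 1 : ℕ) * (t / n), g s =
      ∑ s ∈ J, g s := by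
  have hmem : ∀ s, s ∈ J ↔ 0 < s ∧ s ≤ t ∧ leftVal f s ≠ f s := fun s => by
    rw [← Finset.mem_coe, hJ]; rfl
  rw [sum_cells (monotone_grid (t / n)) (fun s hs => by simpa using ((hmem s).1 hs).1) g n,
    Finset.filter_true_of_mem]
  intro s hs
  rw [mul_div_cancel₀ t (by exact_mod_cast hn)]
  exact ((hmem s).1 hs).2.1

/-- Once t/n is smaller than every gap between jump times, each cell holds at most one jump, and its
endpoint values are the values before and after that jump. -/
theorem IsCadlag.eventually_gridSum_eq [Fintype E] [DecidableEq E] (hf : IsCadlag f) (a : E → E → ℝ) (t : ℝ≥0) :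
    ∀ᶠ n : ℕ in atTop, gridSum (offDiag a) f t n =
      ∑ x, ∑ y with y ≠ x, a x y * jumpCount f x y t := by
  have hfin := hf.finite_jumpTimes t
  have hJ : ↑hfin.toFinset = jumpTimes f t := hfin.coe_toFinset
  rw [hf.sum_jumpCount hJ a]
  have hsep : ∀ᶠ n : ℕ in atTop, ∀ s ∈ hfin.toFinset, ∀ s' ∈ hfin.toFinset,
      s < s' → s + t / n < s' := by
    simp only [Filter.eventually_all_finset]
    intro s _ s' _
    by_cases h : s < s'
    · have h1 : Tendsto (fun n : ℕ => s + t / (n : ℝ≥0)) atTop (𝓝 s) := by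
        have := (tendsto_const_nhds (x := s)).add
          (tendsto_const_div_atTop_nhds_zero_nat t)
        simpa using this
      filter_upwards [h1.eventually_lt_const h] with n hn _ using hn
    · exact Eventually.of_forall fun n h' => absurd h' h
  filter_upwards [hsep, eventually_ne_atTop 0] with n hn hn0
  rw [← sum_grid_cells hJ _ hn0, gridSum]
  refine Finset.sum_congr rfl fun k hk => ?_
  refine hf.cell_eq_sum hJ (by simp [offDiag]) (monotone_grid _ k.le_succ)
    (grid_le (Finset.mem_range.1 hk) t) fun s hs s' hs' h1 h2 h3 => ?_
  have h4 := hn s hs s' hs' h2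
  have h5 : ((k + 1 : ℕ) : ℝ≥0) * (t / n) = k * (t / n) + t / n := by push_cast; ring
  rw [h5] at h3
  exact absurd (h4.trans_le h3) (not_lt.2 (add_le_add_left h1.le _))

/-- A cell with distinct endpoint values contains a jump. Unlike the exact identity this holds for
every n, and so provides the dominating function. -/
theorem IsCadlag.gridSum_le [Fintype E] [DecidableEq E] (hf : IsCadlag f) (t : ℝ≥0) (n : ℕ) :
    gridSum (offDiag fun _ _ => 1) f t n ≤
      ∑ x, ∑ y with y ≠ x, (1 : ℝ) * jumpCount f x y t := by
  have hfin := hf.finite_jumpTimes t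
  have hJ : ↑hfin.toFinset = jumpTimes f t := hfin.coe_toFinset
  have hmem : ∀ s, s ∈ hfin.toFinset ↔ 0 < s ∧ s ≤ t ∧ leftVal f s ≠ f s := fun s => by
    rw [← Finset.mem_coe, hJ]; rfl
  rcases eq_or_ne n 0 with rfl | hn0
  · simp only [gridSum, Finset.range_zero, Finset.sum_empty]
    positivity
  rw [hf.sum_jumpCount hJ fun _ _ => 1, ← sum_grid_cells hJ _ hn0, gridSum]
  refine Finset.sum_le_sum fun k hk => ?_
  have hnn : ∀ x y : E, 0 ≤ offDiag (fun _ _ => 1) x y := fun x y => by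
    rw [offDiag]; split_ifs <;> norm_num
  by_cases h : f (k * (t / n)) = f ((k + 1 : ℕ) * (t / n))
  · rw [offDiag, if_pos h]
    exact Finset.sum_nonneg fun s _ => hnn _ _
  · have hex : ∃ s, k * (t / n) < s ∧ s ≤ (k + 1 : ℕ) * (t / n) ∧ leftVal f s ≠ f s := by
      by_contra! hcon
      exact h (hf.eq_of_no_jump (monotone_grid _ k.le_succ) hcon)
    obtain ⟨s, h1, h2, h3⟩ := hex
    have hsJ := (hmem s).2 ⟨zero_le.trans_lt h1,
      h2.trans (grid_le (Finset.mem_range.1 hk) t), h3⟩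
    rw [offDiag, if_neg h]
    refine le_trans ?_ (Finset.single_le_sum (fun s _ => hnn _ _)
      (Finset.mem_filter.2 ⟨hsJ, h1, h2⟩))
    rw [offDiag, if_neg h3]

theorem abs_gridSum_le [DecidableEq E] {a : E → E → ℝ} {C : ℝ} (hC : ∀ x y, |a x y| ≤ C) (f : ℝ≥0 → E)
    (t : ℝ≥0) (n : ℕ) :
    |gridSum (offDiag a) f t n| ≤ C * gridSum (offDiag fun _ _ => 1) f t n := by
  rw [gridSum, gridSum, Finset.mul_sum]
  refine (Finset.abs_sum_le_sum_abs _ _).trans (Finset.sum_le_sum fun k _ => ?_)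
  simp only [offDiag]
  split_ifs
  · simp
  · simpa using hC _ _

end Paths

end JumpChain

end

noncomputable section

namespace JumpChain

variable {E : Type*} [Fintype E] [DecidableEq E]

/-! ### Integrals of functions of a finite-valued variable. -/

section FiniteValued

variable {Ω : Type*} {ι : Type*} [Fintype ι] [DecidableEq ι] {Y : Ω → ι}

theorem comp_eq_sum_indicator (Y : Ω → ι) (F : ι → ℝ) :
    (fun ω => F (Y ω)) = fun ω => ∑ i, {ω | Y ω = i}.indicator (fun _ => F i) ω := by
  ext ω
  simp [Set.indicator_apply]

variable [MeasurableSpace Ω]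

theorem measurable_comp_of_finite (hY : ∀ i, MeasurableSet {ω | Y ω = i}) (F : ι → ℝ) :
    Measurable fun ω => F (Y ω) := by
  rw [comp_eq_sum_indicator]
  exact Finset.measurable_fun_sum _ fun i _ => measurable_const.indicator (hY i)

variable (μ : Measure Ω) [IsProbabilityMeasure μ]

theorem integrable_comp_of_finite (hY : ∀ i, MeasurableSet {ω | Y ω = i}) (F : ι → ℝ) :
    Integrable (fun ω => F (Y ω)) μ := by
  rw [comp_eq_sum_indicator]
  exact integrable_finsetSum _ fun i _ => (integrable_const _).indicator (hY i)

theorem integral_comp_of_finite (hY : ∀ i, MeasurableSet {ω | Y ω = i}) (F : ι → ℝ) :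
    ∫ ω, F (Y ω) ∂μ = ∑ i, F i * μ.real {ω | Y ω = i} := by
  rw [comp_eq_sum_indicator, integral_finsetSum _
    fun i _ => (integrable_const _).indicator (hY i)]
  refine Finset.sum_congr rfl fun i _ => ?_
  rw [integral_indicator_const _ (hY i), smul_eq_mul, mul_comm]

end FiniteValued

/-! ### The functional ⟨p| · |-⟩ and the jump-weighted matrices. -/

section Bracket

/-- The functional `M ↦ ⟨p| M |-⟩`. -/
def bracket (p : E → ℝ) : Matrix E E ℝ →ₗ[ℝ] ℝ where
  toFun M := p ⬝ᵥ (M *ᵥ 1)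
  map_add' M N := by rw [Matrix.add_mulVec, dotProduct_add]
  map_smul' c M := by rw [Matrix.smul_mulVec, dotProduct_smul, RingHom.id_apply]

omit [DecidableEq E] in
theorem bracket_apply (p : E → ℝ) (M : Matrix E E ℝ) : bracket p M = p ⬝ᵥ (M *ᵥ 1) := rfl

omit [DecidableEq E] in
theorem continuous_bracket (p : E → ℝ) : Continuous (bracket p) := by
  change Continuous fun M : Matrix E E ℝ => p ⬝ᵥ (M *ᵥ 1)
  fun_prop

omit [DecidableEq E] in
theorem bracket_eq_sum (p : E → ℝ) (M : Matrix E E ℝ) : bracket p M = ∑ x, ∑ y, p x * M x y := by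
  simp [bracket_apply, dotProduct, Matrix.mulVec, Finset.mul_sum]

-- Q has rank one, so the bracket factorizes; this turns the Q part of the correlations into the
-- squared mean.
omit [DecidableEq E] in
theorem bracket_mul_oneProj_mul (p : E → ℝ) (M N : Matrix E E ℝ) :
    bracket p (M * oneProj p * N) = bracket p M * bracket p N := by
  rw [bracket_apply, oneProj, Matrix.mul_vecMulVec, Matrix.vecMulVec_mul, bracket_apply,
    bracket_apply, Matrix.dotProduct_mulVec p N, Matrix.vecMulVec_mulVec, dotProduct_smul]
  simp

/-- The entrywise product of a matrix with coefficients off the diagonal. -/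
def jumpMat (a : E → E → ℝ) : Matrix E E ℝ →ₗ[ℝ] Matrix E E ℝ where
  toFun P := Matrix.of fun x y => P x y * offDiag a x y
  map_add' M N := by ext; simp [add_mul]
  map_smul' c M := by ext; simp [mul_assoc]

omit [Fintype E] in
theorem jumpMat_apply (a : E → E → ℝ) (P : Matrix E E ℝ) (x y : E) :
    jumpMat a P x y = P x y * offDiag a x y := rfl

omit [Fintype E] in
theorem continuous_jumpMat (a : E → E → ℝ) : Continuous (jumpMat a) := by
  refine continuous_matrix fun x y => ?_
  simp only [jumpMat_apply]
  fun_prop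

omit [Fintype E] in
theorem jumpMat_one (a : E → E → ℝ) : jumpMat a 1 = 0 := by
  ext x y
  rw [jumpMat_apply, offDiag]
  split_ifs with h <;> simp [h]

theorem tiltedGeneratorDeriv_eq (w a : E → E → ℝ) :
    tiltedGeneratorDeriv w a = jumpMat a (generator w) := by
  ext x y
  rw [jumpMat_apply, offDiag]
  simp only [tiltedGeneratorDeriv, tiltedGenerator, Matrix.add_apply, Matrix.of_apply, generator]
  split_ifs with h
  · simp
  · have h1 : HasDerivAt (fun u : ℝ => (Real.exp (u * a x y) - 1) * w x y + w x y)
        (Real.exp (0 * a x y) * (1 * a x y) * w x y) 0 :=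
      ((((hasDerivAt_id (0 : ℝ)).mul_const (a x y)).exp.sub_const 1).mul_const (w x y)).add_const _
    rw [h1.deriv]
    simp [mul_comm]

theorem meanSq_eq (w a : E → E → ℝ) (p : E → ℝ) :
    meanSq w a p = bracket p (jumpMat (fun x y => a x y ^ 2) (generator w)) := by
  rw [bracket_eq_sum, meanSq]
  refine Finset.sum_congr rfl fun x _ => ?_
  rw [Finset.sum_filter]
  refine Finset.sum_congr rfl fun y _ => ?_
  rw [jumpMat_apply, offDiag]
  by_cases h : x = y
  · simp [h]
  · rw [if_pos (Ne.symm h), if_neg h, generator, Matrix.of_apply, if_neg h, mul_assoc]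

/-- Since b vanishes on the diagonal, J_a(1) = 0 and J_a(P) = J_a(P - 1) is of order h. -/
theorem tendsto_jumpMat_exp (w a : E → E → ℝ) :
    Tendsto (fun h : ℝ => h⁻¹ • jumpMat a (NormedSpace.exp (h • generator w))) (𝓝[≠] 0)
      (𝓝 (jumpMat a (generator w))) := by
  have h := ((continuous_jumpMat a).tendsto _).comp (tendsto_slope_exp (generator w))
  refine h.congr fun s => ?_
  rw [Function.comp, map_smul, map_sub, jumpMat_one, sub_zero]

end Bracket

/-! ### Moments of the grid sums, passage to the limit, and the asymptotics. -/

section Moments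

variable {w : E → E → ℝ} {p : E → ℝ} {Ω : Type*} [MeasurableSpace Ω] {μ : Measure Ω}
  [IsProbabilityMeasure μ] {X : ℝ≥0 → Ω → E}

omit [IsProbabilityMeasure μ] in
theorem IsMarkovChain.measurableSet_pair (hX : IsMarkovChain w p μ X) (s t : ℝ≥0) (i : E × E) :
    MeasurableSet {ω | (X s ω, X t ω) = i} := by
  have : {ω | (X s ω, X t ω) = i} = {ω | X s ω = i.1} ∩ {ω | X t ω = i.2} := by
    ext; simp [Prod.ext_iff]
  rw [this]
  exact (hX.measurableSet_eq s i.1).inter (hX.measurableSet_eq t i.2)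

omit [IsProbabilityMeasure μ] in
theorem IsMarkovChain.measurableSet_quad (hX : IsMarkovChain w p μ X) (s t u v : ℝ≥0)
    (i : (E × E) × (E × E)) :
    MeasurableSet {ω | ((X s ω, X t ω), (X u ω, X v ω)) = i} := by
  have : {ω | ((X s ω, X t ω), (X u ω, X v ω)) = i} =
      {ω | (X s ω, X t ω) = i.1} ∩ {ω | (X u ω, X v ω) = i.2} := by
    ext; simp [Prod.ext_iff]
  rw [this]
  exact (hX.measurableSet_pair s t i.1).inter (hX.measurableSet_pair u v i.2)

omit [IsProbabilityMeasure μ] in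
theorem IsMarkovChain.real_pair (hX : IsMarkovChain w p μ X) (hp : IsStationary w p)
    {s t : ℝ≥0} (hst : s ≤ t) (x y : E) :
    μ.real {ω | (X s ω, X t ω) = (x, y)} =
      p x * NormedSpace.exp (((t : ℝ) - s) • generator w) x y := by
  have h := hX.finDimDistrib 1 ![s, t] ![x, y]
    (Fin.monotone_iff_le_succ.2 (by simpa [Fin.forall_fin_succ] using hst))
  simp only [hp.vecMul_exp] at h
  simpa [Fin.forall_fin_succ, Prod.ext_iff] using h

omit [IsProbabilityMeasure μ] in
theorem IsMarkovChain.real_quad (hX : IsMarkovChain w p μ X) (hp : IsStationary w p)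
    {s t u v : ℝ≥0} (hst : s ≤ t) (htu : t ≤ u) (huv : u ≤ v) (x y z z' : E) :
    μ.real {ω | ((X s ω, X t ω), (X u ω, X v ω)) = ((x, y), (z, z'))} =
      p x * (NormedSpace.exp (((t : ℝ) - s) • generator w) x y *
        (NormedSpace.exp (((u : ℝ) - t) • generator w) y z *
          NormedSpace.exp (((v : ℝ) - u) • generator w) z z')) := by
  have h := hX.finDimDistrib 3 ![s, t, u, v] ![x, y, z, z']
    (Fin.monotone_iff_le_succ.2 (by simpa [Fin.forall_fin_succ] using ⟨hst, htu, huv⟩))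
  simp only [hp.vecMul_exp] at h
  simpa [Fin.forall_fin_succ, Prod.ext_iff, Fin.prod_univ_succ, and_assoc] using h

theorem IsMarkovChain.integral_pair (hX : IsMarkovChain w p μ X) (hp : IsStationary w p)
    {s t : ℝ≥0} (hst : s ≤ t) (a : E → E → ℝ) :
    ∫ ω, offDiag a (X s ω) (X t ω) ∂μ =
      bracket p (jumpMat a (NormedSpace.exp (((t : ℝ) - s) • generator w))) := by
  rw [integral_comp_of_finite (Y := fun ω => (X s ω, X t ω)) μ (hX.measurableSet_pair s t)
    (fun i => offDiag a i.1 i.2), Fintype.sum_prod_type, bracket_eq_sum]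
  refine Finset.sum_congr rfl fun x _ => Finset.sum_congr rfl fun y _ => ?_
  rw [hX.real_pair hp hst, jumpMat_apply]
  ring

theorem IsMarkovChain.integral_quad (hX : IsMarkovChain w p μ X) (hp : IsStationary w p)
    {s t u v : ℝ≥0} (hst : s ≤ t) (htu : t ≤ u) (huv : u ≤ v) (a : E → E → ℝ) :
    ∫ ω, offDiag a (X s ω) (X t ω) * offDiag a (X u ω) (X v ω) ∂μ =
      bracket p (jumpMat a (NormedSpace.exp (((t : ℝ) - s) • generator w)) *
        NormedSpace.exp (((u : ℝ) - t) • generator w) *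
        jumpMat a (NormedSpace.exp (((v : ℝ) - u) • generator w))) := by
  rw [integral_comp_of_finite (Y := fun ω => ((X s ω, X t ω), (X u ω, X v ω))) μ
    (hX.measurableSet_quad s t u v)
    (fun i => offDiag a i.1.1 i.1.2 * offDiag a i.2.1 i.2.2), Fintype.sum_prod_type,
    Fintype.sum_prod_type, bracket_eq_sum]
  refine Finset.sum_congr rfl fun x _ => ?_
  simp only [Fintype.sum_prod_type, hX.real_quad hp hst htu huv, mul_assoc, Matrix.mul_apply,
    jumpMat_apply, Finset.mul_sum, Finset.sum_mul]
  rw [Finset.sum_comm]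
  refine Eq.trans (Finset.sum_congr rfl fun z _ => ?_) Finset.sum_comm
  rw [Finset.sum_comm]
  refine Finset.sum_congr rfl fun z' _ => Finset.sum_congr rfl fun y _ => ?_
  ring

/-- The increments of the discretized observable. -/
def gridStep (a : E → E → ℝ) (X : ℝ≥0 → Ω → E) (h : ℝ≥0) (k : ℕ) (ω : Ω) : ℝ :=
  offDiag a (X (k * h) ω) (X ((k + 1 : ℕ) * h) ω)

omit [IsProbabilityMeasure μ] in
theorem IsMarkovChain.measurable_gridStep (hX : IsMarkovChain w p μ X) (a : E → E → ℝ)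
    (h : ℝ≥0) (k : ℕ) : Measurable (gridStep a X h k) :=
  measurable_comp_of_finite (Y := fun ω => (X (k * h) ω, X ((k + 1 : ℕ) * h) ω))
    (hX.measurableSet_pair _ _) (fun i => offDiag a i.1 i.2)

theorem IsMarkovChain.integrable_gridStep (hX : IsMarkovChain w p μ X) (a : E → E → ℝ)
    (h : ℝ≥0) (k : ℕ) : Integrable (gridStep a X h k) μ :=
  integrable_comp_of_finite (Y := fun ω => (X (k * h) ω, X ((k + 1 : ℕ) * h) ω)) μ
    (hX.measurableSet_pair _ _) (fun i => offDiag a i.1 i.2)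

theorem IsMarkovChain.integrable_gridStep_mul (hX : IsMarkovChain w p μ X) (a : E → E → ℝ)
    (h : ℝ≥0) (j k : ℕ) : Integrable (fun ω => gridStep a X h j ω * gridStep a X h k ω) μ :=
  integrable_comp_of_finite (Y := fun ω => ((X (j * h) ω, X ((j + 1 : ℕ) * h) ω),
    (X (k * h) ω, X ((k + 1 : ℕ) * h) ω))) μ
    (hX.measurableSet_quad _ _ _ _) (fun i => offDiag a i.1.1 i.1.2 * offDiag a i.2.1 i.2.2)

theorem grid_sub (h : ℝ≥0) (k : ℕ) :
    (((k + 1 : ℕ) * h : ℝ≥0) : ℝ) - ((k * h : ℝ≥0) : ℝ) = h := by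
  push_cast; ring

theorem IsMarkovChain.integral_gridStep (hX : IsMarkovChain w p μ X) (hp : IsStationary w p)
    (a : E → E → ℝ) (h : ℝ≥0) (k : ℕ) :
    ∫ ω, gridStep a X h k ω ∂μ =
      bracket p (jumpMat a (NormedSpace.exp ((h : ℝ) • generator w))) := by
  simp only [gridStep]
  rw [hX.integral_pair hp (monotone_grid h k.le_succ), grid_sub]

theorem IsMarkovChain.integral_gridStep_sq (hX : IsMarkovChain w p μ X) (hp : IsStationary w p)
    (a : E → E → ℝ) (h : ℝ≥0) (k : ℕ) :
    ∫ ω, gridStep a X h k ω ^ 2 ∂μ =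
      bracket p (jumpMat (fun x y => a x y ^ 2) (NormedSpace.exp ((h : ℝ) • generator w))) := by
  rw [← hX.integral_gridStep hp _ h k]
  congr 1
  ext ω
  simp only [gridStep, offDiag]
  split_ifs <;> simp

theorem IsMarkovChain.integral_gridStep_mul (hX : IsMarkovChain w p μ X) (hp : IsStationary w p)
    (a : E → E → ℝ) (h : ℝ≥0) {j k : ℕ} (hjk : j < k) :
    ∫ ω, gridStep a X h j ω * gridStep a X h k ω ∂μ =
      bracket p (jumpMat a (NormedSpace.exp ((h : ℝ) • generator w)) *
        NormedSpace.exp ((h : ℝ) • generator w) ^ (k - 1 - j) *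
        jumpMat a (NormedSpace.exp ((h : ℝ) • generator w))) := by
  simp only [gridStep]
  rw [hX.integral_quad hp (monotone_grid h j.le_succ) (monotone_grid h hjk)
    (monotone_grid h k.le_succ), grid_sub, grid_sub, ← Matrix.exp_nsmul,
    ← Nat.cast_smul_eq_nsmul ℝ, smul_smul]
  congr 6
  -- Step j ends at (j + 1)h and step k starts at kh, so k - 1 - j steps separate them.
  obtain ⟨d, rfl⟩ := Nat.exists_eq_add_of_lt hjk
  have : j + d + 1 - 1 - j = d := by omega
  rw [this]
  push_cast
  ring

theorem IsMarkovChain.integral_sum_gridStep (hX : IsMarkovChain w p μ X)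
    (hp : IsStationary w p) (a : E → E → ℝ) (h : ℝ≥0) (n : ℕ) :
    ∫ ω, ∑ k ∈ Finset.range n, gridStep a X h k ω ∂μ =
      n * bracket p (jumpMat a (NormedSpace.exp ((h : ℝ) • generator w))) := by
  rw [integral_finsetSum _ fun k _ => hX.integrable_gridStep a h k]
  simp [hX.integral_gridStep hp]

theorem IsMarkovChain.integral_sum_gridStep_sq (hX : IsMarkovChain w p μ X)
    (hp : IsStationary w p) (a : E → E → ℝ) (h : ℝ≥0) (n : ℕ) :
    Integrable (fun ω => (∑ k ∈ Finset.range n, gridStep a X h k ω) ^ 2) μ ∧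
    ∫ ω, (∑ k ∈ Finset.range n, gridStep a X h k ω) ^ 2 ∂μ =
      n * bracket p (jumpMat (fun x y => a x y ^ 2) (NormedSpace.exp ((h : ℝ) • generator w))) +
      2 * bracket p (jumpMat a (NormedSpace.exp ((h : ℝ) • generator w)) *
        (∑ m ∈ Finset.range n, ∑ i ∈ Finset.range m,
          NormedSpace.exp ((h : ℝ) • generator w) ^ i) *
        jumpMat a (NormedSpace.exp ((h : ℝ) • generator w))) := by
  induction n with
  | zero => simp
  | succ n ih =>
    obtain ⟨ih1, ih2⟩ := ih
    have e : ∀ ω, (∑ k ∈ Finset.range (n + 1), gridStep a X h k ω) ^ 2 =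
        ((∑ k ∈ Finset.range n, gridStep a X h k ω) ^ 2 +
          2 * ∑ k ∈ Finset.range n, gridStep a X h k ω * gridStep a X h n ω) +
          gridStep a X h n ω ^ 2 := by
      intro ω
      rw [Finset.sum_range_succ, ← Finset.sum_mul]
      ring
    have i2 : Integrable (fun ω => ∑ k ∈ Finset.range n,
        gridStep a X h k ω * gridStep a X h n ω) μ :=
      integrable_finsetSum _ fun k _ => hX.integrable_gridStep_mul a h k n
    have i3 : Integrable (fun ω => gridStep a X h n ω ^ 2) μ := by
      simpa only [pow_two] using hX.integrable_gridStep_mul a h n n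
    simp only [e]
    have i12 : Integrable (fun ω => (∑ k ∈ Finset.range n, gridStep a X h k ω) ^ 2 +
        2 * ∑ k ∈ Finset.range n, gridStep a X h k ω * gridStep a X h n ω) μ :=
      ih1.add (i2.const_mul 2)
    refine ⟨i12.add i3, ?_⟩
    -- The cross terms with step n carry P^(n-1-k) for k < n; reflected, they form the row m = n of
    -- the double sum.
    rw [integral_add i12 i3, integral_add ih1 (i2.const_mul 2), ih2,
      hX.integral_gridStep_sq hp, integral_const_mul,
      integral_finsetSum _ fun k _ => hX.integrable_gridStep_mul a h k n,
      Finset.sum_congr rfl fun k hk => hX.integral_gridStep_mul hp a h (Finset.mem_range.1 hk),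
      ← map_sum, ← Finset.sum_mul, ← Finset.mul_sum,
      Finset.sum_range_reflect (fun i => NormedSpace.exp ((h : ℝ) • generator w) ^ i) n,
      Finset.sum_range_succ (fun m => ∑ i ∈ Finset.range m, _), mul_add, add_mul, map_add]
    push_cast
    ring

theorem coe_grid (t : ℝ≥0) (n : ℕ) : ((t / (n : ℝ≥0) : ℝ≥0) : ℝ) = (t : ℝ) / n := by
  push_cast; rfl

theorem IsMarkovChain.tendsto_integral_gridSum (hX : IsMarkovChain w p μ X)
    (hp : IsStationary w p) (a : E → E → ℝ) {t : ℝ≥0} (ht : 0 < t) :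
    Tendsto (fun n : ℕ => ∫ ω, gridSum (offDiag a) (fun s => X s ω) t n ∂μ) atTop
      (𝓝 (t * bracket p (jumpMat a (generator w)))) := by
  have ht' : (0 : ℝ) < t := by exact_mod_cast ht
  have h1 := (tendsto_jumpMat_exp w a).comp (tendsto_grid ht')
  have h2 := (((continuous_bracket p).tendsto _).comp h1).const_mul (t : ℝ)
  refine h2.congr' ?_
  filter_upwards [eventually_gt_atTop 0] with n hn
  have hn' : (n : ℝ) ≠ 0 := by exact_mod_cast hn.ne'
  refine Eq.trans ?_ (hX.integral_sum_gridStep hp a (t / n) n).symm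
  rw [coe_grid]
  simp only [Function.comp, map_smul, smul_eq_mul]
  field_simp

theorem IsMarkovChain.tendsto_integral_gridSum_sq (hX : IsMarkovChain w p μ X)
    (hp : IsStationary w p) (hu : IsUnit (generator w + oneProj p)) (a : E → E → ℝ) {t : ℝ≥0}
    (ht : 0 < t) :
    Tendsto (fun n : ℕ => ∫ ω, gridSum (offDiag a) (fun s => X s ω) t n ^ 2 ∂μ) atTop
      (𝓝 (t * meanSq w a p + 2 * bracket p (jumpMat a (generator w) *
        ((NormedSpace.exp ((t : ℝ) • generator w) - 1) * pseudoinverse w p ^ 2 -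
          (t : ℝ) • pseudoinverse w p) * jumpMat a (generator w)) +
        (t * bracket p (jumpMat a (generator w))) ^ 2)) := by
  have ht' : (0 : ℝ) < t := by exact_mod_cast ht
  have h1 := (tendsto_jumpMat_exp w a).comp (tendsto_grid ht')
  have h2 := (tendsto_jumpMat_exp w fun x y => a x y ^ 2).comp (tendsto_grid ht')
  have h3 := tendsto_sq_smul_sum_geom hp hu ht'
  have h4 := ((((continuous_bracket p).tendsto _).comp h2).const_mul (t : ℝ)).add
    ((((continuous_bracket p).tendsto _).comp ((h1.mul h3).mul h1)).const_mul 2)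
  rw [← meanSq_eq, mul_add, add_mul, map_add, mul_smul_comm, smul_mul_assoc, map_smul,
    bracket_mul_oneProj_mul] at h4
  convert h4.congr' ?_ using 2
  · rw [smul_eq_mul]; ring
  filter_upwards [eventually_gt_atTop 0] with n hn
  have hn' : (n : ℝ) ≠ 0 := by exact_mod_cast hn.ne'
  refine Eq.trans ?_ (hX.integral_sum_gridStep_sq hp a (t / n) n).2.symm
  rw [coe_grid]
  simp only [Function.comp, map_smul, smul_eq_mul, smul_mul_assoc, mul_smul_comm]
  field_simp

omit [IsProbabilityMeasure μ] in
theorem IsMarkovChain.measurable_gridSum (hX : IsMarkovChain w p μ X) (a : E → E → ℝ)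
    (t : ℝ≥0) (n : ℕ) : Measurable fun ω => gridSum (offDiag a) (fun s => X s ω) t n :=
  Finset.measurable_fun_sum _ fun k _ => hX.measurable_gridStep a (t / n) k

theorem IsMarkovChain.memLp_gridSum (hX : IsMarkovChain w p μ X) (hp : IsStationary w p)
    (a : E → E → ℝ) (t : ℝ≥0) (n : ℕ) :
    MemLp (fun ω => gridSum (offDiag a) (fun s => X s ω) t n) 2 μ :=
  (memLp_two_iff_integrable_sq (hX.measurable_gridSum a t n).aestronglyMeasurable).2
    (hX.integral_sum_gridStep_sq hp a (t / n) n).1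

omit [IsProbabilityMeasure μ] in
theorem IsMarkovChain.ae_isCadlag (hX : IsMarkovChain w p μ X) :
    ∀ᵐ ω ∂μ, IsCadlag fun s => X s ω := by
  filter_upwards [hX.rightCont, hX.leftLim] with ω h1 h2 using ⟨h1, h2⟩

omit [IsProbabilityMeasure μ] in
theorem IsMarkovChain.ae_tendsto_gridSum (hX : IsMarkovChain w p μ X) (a : E → E → ℝ)
    (t : ℝ≥0) : ∀ᵐ ω ∂μ, Tendsto (fun n => gridSum (offDiag a) (fun s => X s ω) t n) atTop
      (𝓝 (observable a X t ω)) := by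
  filter_upwards [hX.ae_isCadlag] with ω hω
  exact tendsto_const_nhds.congr' ((hω.eventually_gridSum_eq a t).mono fun n hn => hn.symm)

/-- The total number of jumps in `(0, t]` is square integrable. -/
theorem IsMarkovChain.memLp_count (hX : IsMarkovChain w p μ X) (hp : IsStationary w p)
    (hu : IsUnit (generator w + oneProj p)) {t : ℝ≥0} (ht : 0 < t) :
    MemLp (observable (fun _ _ => 1) X t) 2 μ := by
  have hlim := hX.ae_tendsto_gridSum (fun _ _ => 1) t
  have hm := fun n => (hX.measurable_gridSum (fun _ _ => 1) t n).aestronglyMeasurable (μ := μ)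
  refine ⟨aestronglyMeasurable_of_tendsto_ae atTop hm hlim, ?_⟩
  obtain ⟨M, hM⟩ := (hX.tendsto_integral_gridSum_sq hp hu (fun _ _ => 1) ht).bddAbove_range
  -- Fatou: the second moments of the grid sums converge, hence are bounded by some M, and the L²
  -- norms by √M.
  refine (Lp.eLpNorm_lim_le_liminf_eLpNorm hm _ hlim).trans_lt ?_
  refine lt_of_le_of_lt (b := ENNReal.ofReal (M ^ (2⁻¹ : ℝ))) ?_ ENNReal.ofReal_lt_top
  refine liminf_le_of_frequently_le' (Eventually.of_forall fun n => ?_).frequently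
  rw [(hX.memLp_gridSum hp _ t n).eLpNorm_eq_integral_rpow_norm (by norm_num) (by norm_num)]
  refine ENNReal.ofReal_le_ofReal ?_
  simp only [ENNReal.toReal_ofNat, Real.rpow_two, Real.norm_eq_abs, sq_abs]
  exact Real.rpow_le_rpow (integral_nonneg fun ω => sq_nonneg _) (hM ⟨n, rfl⟩) (by norm_num)

/-- Dominated convergence along the grid, with C times the number of jumps as bound for S_n and its
square as bound for S_n². -/
theorem IsMarkovChain.moments (hX : IsMarkovChain w p μ X) (hp : IsStationary w p)
    (hu : IsUnit (generator w + oneProj p)) (a : E → E → ℝ) {t : ℝ≥0} (ht : 0 < t) :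
    MemLp (observable a X t) 2 μ ∧
    ∫ ω, observable a X t ω ∂μ = t * bracket p (jumpMat a (generator w)) ∧
    ∫ ω, observable a X t ω ^ 2 ∂μ =
      t * meanSq w a p + 2 * bracket p (jumpMat a (generator w) *
        ((NormedSpace.exp ((t : ℝ) • generator w) - 1) * pseudoinverse w p ^ 2 -
          (t : ℝ) • pseudoinverse w p) * jumpMat a (generator w)) +
        (t * bracket p (jumpMat a (generator w))) ^ 2 := by
  have hN := hX.memLp_count hp hu ht
  have hlim := hX.ae_tendsto_gridSum a t
  have hm := fun n => (hX.measurable_gridSum a t n).aestronglyMeasurable (μ := μ)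
  obtain ⟨C, hC⟩ : ∃ C, ∀ x y, |a x y| ≤ C := by
    obtain ⟨C, hC⟩ := (Set.finite_range fun i : E × E => |a i.1 i.2|).bddAbove
    exact ⟨C, fun x y => hC ⟨(x, y), rfl⟩⟩
  have hC0 : 0 ≤ C := by
    by_contra hneg
    have : IsEmpty E := ⟨fun x => hneg ((abs_nonneg _).trans (hC x x))⟩
    simpa using hp.sum_eq_one
  have hbound : ∀ᵐ ω ∂μ, ∀ n, |gridSum (offDiag a) (fun s => X s ω) t n| ≤
      C * observable (fun _ _ => 1) X t ω := by
    filter_upwards [hX.ae_isCadlag] with ω hω n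
    exact (abs_gridSum_le hC _ t n).trans (mul_le_mul_of_nonneg_left (hω.gridSum_le t n) hC0)
  have hCN := hN.const_mul C
  have hmem : MemLp (observable a X t) 2 μ := by
    refine hCN.mono (aestronglyMeasurable_of_tendsto_ae atTop hm hlim) ?_
    filter_upwards [hlim, hbound] with ω h1 h2
    exact (le_of_tendsto' h1.abs h2).trans (le_abs_self _)
  refine ⟨hmem, ?_, ?_⟩
  · refine tendsto_nhds_unique ?_ (hX.tendsto_integral_gridSum hp a ht)
    refine tendsto_integral_of_dominated_convergence _ hm (hCN.integrable (by norm_num)) ?_ hlim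
    intro n
    filter_upwards [hbound] with ω h using h n
  · refine tendsto_nhds_unique ?_ (hX.tendsto_integral_gridSum_sq hp hu a ht)
    refine tendsto_integral_of_dominated_convergence
      (fun ω => (C * observable (fun _ _ => 1) X t ω) ^ 2) (fun n => (hm n).pow 2)
      hCN.integrable_sq ?_ (hlim.mono fun ω h => h.pow 2)
    intro n
    filter_upwards [hbound] with ω h
    rw [Real.norm_eq_abs, abs_pow]
    exact pow_le_pow_left₀ (abs_nonneg _) (h n) 2

omit [MeasurableSpace Ω] in
theorem observable_zero (a : E → E → ℝ) (X : ℝ≥0 → Ω → E) : observable a X 0 = 0 := by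
  ext ω
  have h : ∀ x y, jumpCount (fun s => X s ω) x y 0 = 0 := fun x y => by
    rw [jumpCount]
    convert Set.ncard_empty ℝ≥0
    ext s
    simp only [Set.mem_ofPred_eq, Set.mem_empty_iff_false, iff_false]
    exact fun hs => absurd hs.1 (not_lt.2 hs.2.1)
  simp [observable, h]

theorem IsMarkovChain.memLp_and_variance (hX : IsMarkovChain w p μ X) (hp : IsStationary w p)
    (hu : IsUnit (generator w + oneProj p)) (a : E → E → ℝ) (t : ℝ≥0) :
    MemLp (observable a X t) 2 μ ∧
    Var[observable a X t; μ] =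
      t * meanSq w a p + 2 * bracket p (jumpMat a (generator w) *
        ((NormedSpace.exp ((t : ℝ) • generator w) - 1) * pseudoinverse w p ^ 2 -
          (t : ℝ) • pseudoinverse w p) * jumpMat a (generator w)) := by
  rcases eq_or_lt_of_le (zero_le (a := t)) with rfl | ht
  · rw [observable_zero]
    refine ⟨MemLp.zero, ?_⟩
    simp [variance_zero]
  · obtain ⟨h1, h2, h3⟩ := hX.moments hp hu a ht
    refine ⟨h1, ?_⟩
    rw [variance_eq_sub h1, h2]
    simp only [Pi.pow_apply, h3]
    ring

/-- p x times this entry is the probability of being at x at time 0 and at y at time t. Boundedness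
of e^{tW} thus needs no spectral argument. -/
theorem IsMarkovChain.abs_exp_apply_le (hX : IsMarkovChain w p μ X) (hp : IsStationary w p)
    (hpos : ∀ x, 0 < p x) (t : ℝ≥0) (x y : E) :
    |NormedSpace.exp ((t : ℝ) • generator w) x y| ≤ (p x)⁻¹ := by
  have h := hX.real_pair hp (zero_le (a := t)) x y
  rw [NNReal.coe_zero, sub_zero] at h
  have h1 : |p x * NormedSpace.exp ((t : ℝ) • generator w) x y| ≤ 1 := by
    rw [← h, abs_of_nonneg measureReal_nonneg]
    exact measureReal_le_one
  rw [abs_mul, abs_of_pos (hpos x)] at h1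
  rw [← one_div, le_div_iff₀ (hpos x), mul_comm]
  exact h1

theorem IsMarkovChain.tendsto_inv_smul_exp_atTop (hX : IsMarkovChain w p μ X)
    (hp : IsStationary w p) (hpos : ∀ x, 0 < p x) :
    Tendsto (fun t : ℝ≥0 => (t : ℝ)⁻¹ • (NormedSpace.exp ((t : ℝ) • generator w) - 1)) atTop
      (𝓝 0) := by
  refine tendsto_pi_nhds.2 fun x => tendsto_pi_nhds.2 fun y => ?_
  have hinv : Tendsto (fun t : ℝ≥0 => (t : ℝ)⁻¹) atTop (𝓝 0) :=
    tendsto_inv_atTop_zero.comp (NNReal.tendsto_coe_atTop.2 tendsto_id)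
  have hb := hinv.mul_const ((p x)⁻¹ + 1)
  rw [zero_mul] at hb
  refine squeeze_zero_norm (fun t => ?_) hb
  rw [Matrix.smul_apply, Matrix.sub_apply, smul_eq_mul, norm_mul, Real.norm_eq_abs,
    Real.norm_eq_abs, abs_of_nonneg (by positivity : (0 : ℝ) ≤ (t : ℝ)⁻¹)]
  refine mul_le_mul_of_nonneg_left ((abs_sub _ _).trans (add_le_add
    (hX.abs_exp_apply_le hp hpos t x y) ?_)) (by positivity)
  rw [Matrix.one_apply]
  split_ifs <;> norm_num

/-- Serves both asymptotic regimes, with L = 0 at infinity and L = W at zero. -/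
theorem IsMarkovChain.tendsto_variance_div (hX : IsMarkovChain w p μ X) (hp : IsStationary w p)
    (hu : IsUnit (generator w + oneProj p)) (a : E → E → ℝ) {l : Filter ℝ≥0}
    (hl : ∀ᶠ t in l, 0 < t) {L : Matrix E E ℝ}
    (hL : Tendsto (fun t : ℝ≥0 => (t : ℝ)⁻¹ • (NormedSpace.exp ((t : ℝ) • generator w) - 1)) l
      (𝓝 L)) :
    Tendsto (fun t : ℝ≥0 => Var[observable a X t; μ] / (t : ℝ)) l
      (𝓝 (meanSq w a p + 2 * bracket p (jumpMat a (generator w) *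
        (L * pseudoinverse w p ^ 2 - pseudoinverse w p) * jumpMat a (generator w)))) := by
  have h1 := (((hL.mul_const (pseudoinverse w p ^ 2)).sub_const (pseudoinverse w p)).const_mul
    (jumpMat a (generator w))).mul_const (jumpMat a (generator w))
  have h2 := ((((continuous_bracket p).tendsto _).comp h1).const_mul 2).const_add (meanSq w a p)
  refine h2.congr' ?_
  filter_upwards [hl] with t ht
  have ht' : (t : ℝ) ≠ 0 := by exact_mod_cast ht.ne'
  rw [(hX.memLp_and_variance hp hu a t).2]
  simp only [Function.comp, mul_sub, sub_mul, map_sub, map_smul, smul_eq_mul, smul_mul_assoc,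
    mul_smul_comm, smul_sub]
  field_simp

end Moments

end JumpChain

end

theorem mainTheorem3 {E : Type*} [Fintype E] [DecidableEq E]
    (w : E → E → ℝ) (hw : ∀ x y, x ≠ y → 0 ≤ w x y) (hirr : JumpChain.IsIrreducible w)
    (p : E → ℝ) (hp : JumpChain.IsStationary w p) (a : E → E → ℝ)
    {Ω : Type*} [MeasurableSpace Ω] (μ : Measure Ω) [IsProbabilityMeasure μ]
    (X : ℝ≥0 → Ω → E) (hX : JumpChain.IsMarkovChain w p μ X) :
    IsUnit (JumpChain.generator w + JumpChain.oneProj p) ∧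
    (∀ t : ℝ≥0, MemLp (JumpChain.observable a X t) 2 μ ∧
      Var[JumpChain.observable a X t; μ] =
        (t : ℝ) * JumpChain.meanSq w a p +
          2 * (p ⬝ᵥ ((JumpChain.tiltedGeneratorDeriv w a *
            ((NormedSpace.exp ((t : ℝ) • JumpChain.generator w) - 1) *
                JumpChain.pseudoinverse w p ^ 2 - (t : ℝ) • JumpChain.pseudoinverse w p) *
            JumpChain.tiltedGeneratorDeriv w a) *ᵥ 1))) ∧
    Tendsto (fun t : ℝ≥0 => Var[JumpChain.observable a X t; μ] / (t : ℝ)) atTop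
      (𝓝 (JumpChain.meanSq w a p -
        2 * (p ⬝ᵥ ((JumpChain.tiltedGeneratorDeriv w a * JumpChain.pseudoinverse w p *
          JumpChain.tiltedGeneratorDeriv w a) *ᵥ 1)))) ∧
    Tendsto (fun t : ℝ≥0 => Var[JumpChain.observable a X t; μ] / (t : ℝ)) (𝓝[>] 0)
      (𝓝 (JumpChain.meanSq w a p)) := by
  have hu := hp.isUnit_generator_add_oneProj hw hirr
  simp only [← JumpChain.bracket_apply, JumpChain.tiltedGeneratorDeriv_eq]
  refine ⟨hu, hX.memLp_and_variance hp hu a, ?_, ?_⟩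
  · have h := hX.tendsto_variance_div hp hu a (eventually_gt_atTop 0)
      (hX.tendsto_inv_smul_exp_atTop hp (hp.pos hw hirr))
    convert h using 2
    rw [zero_mul, zero_sub, mul_neg, neg_mul, map_neg]
    ring
  · have hcoe : Tendsto (fun t : ℝ≥0 => (t : ℝ)) (𝓝[>] 0) (𝓝[≠] 0) := by
      refine tendsto_nhdsWithin_iff.2 ⟨?_, ?_⟩
      · exact (NNReal.continuous_coe.tendsto 0).mono_left nhdsWithin_le_nhds
      · filter_upwards [self_mem_nhdsWithin] with t ht
        exact NNReal.coe_ne_zero.2 (ne_of_gt ht)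
    have hl : ∀ᶠ t : ℝ≥0 in 𝓝[>] 0, 0 < t := self_mem_nhdsWithin
    have h := hX.tendsto_variance_div hp hu a hl
      ((JumpChain.tendsto_slope_exp (JumpChain.generator w)).comp hcoe)
    rw [JumpChain.generator_mul_pseudoinverse_sq hp hu] at h
    simpa using h
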